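/- Let $\boldsymbol\gamma=(\gamma_j)_{j\ge1}$ be a non-increasing sequence of positive reals. For a prime $b$, an irreducible $p\in\mathbb Z_b[x]$ with $\deg p=m\ge1$, $N=b^m$, $0<\alpha\le1$, $s\ge2$ and $\boldsymbol q=(q_1,\dots,q_s)\in\mathbb Z_b[x]^s$, define $$B(\boldsymbol q,\alpha,\boldsymbol\gamma)=\sum_{\boldsymbol k\in\mathscr D_p(\boldsymbol q)\setminus\{\boldsymbol 0\}}\ \prod_{j=1}^s r_{2\alpha+1,\gamma_j}(k_j),\qquad \mathscr D_p(\boldsymbol q)=\Big\{\boldsymbol k\in\mathbb N_0^s:\ \sum_{j=1}^s \mathrm{tr}_m(k_j)(x)\,q_j(x)\equiv0 \pmod{p(x)}\Big\},$$ where, for $k=\kappa_0+\kappa_1b+\cdots$ in base $b$, $\mathrm{tr}_m(k)(x)=\kappa_0+\kappa_1x+\cdots+\kappa_{m-1}x^{m-1}\in\mathbb Z_b[x]$, and where $r_{\beta,\gamma}(0)=1$ and $r_{\beta,\gamma}(k)=\gamma\,\frac{b}{(b-1)\,b^{\beta a}}$ if $k>0$ has exactly $a$ digits in base $b$. Let $R_{b,m}$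 be the set of nonzero polynomials over $\mathbb Z_b$ of degree less than $m$, let $\psi(q)=(1,q,\dots,q^{s-1}) \pmod p$, and let $q^*\in R_{b,m}$ minimise $q\mapsto B(\psi(q),\alpha,\boldsymbol\gamma)$ over $R_{b,m}$ (the Korobov construction). Put $$C_{b,\alpha,\lambda}=\max\left(\frac1{(b^{2\alpha}-1)^\lambda},\ \frac{(b-1)^{1-\lambda}}{b^{2\alpha\lambda}-b^{1-\lambda}}\right),\qquad c_{s,\alpha,\boldsymbol\gamma,\delta}=\prod_{j=1}^s\left(1+\gamma_j^{\frac1{2\alpha+1-\delta}}\,C_{b,\alpha,(2\alpha+1-\delta)^{-1}}\right)^{2\alpha+1-\delta}.$$ 1. For all $0<\delta\le2\alpha$, $$B(\psi(q^*),\alpha,\boldsymbol\gamma)\le c_{s,\alpha,\boldsymbol\gamma,\delta}\;s^{2\alpha+1-\delta}\,(N-1)^{-(2\alpha+1)+\delta}.$$ 2. Suppose $A:=\limsup_{s\to\infty}\frac{\sum_{j=1}^s\gamma_j}{\log s}<\infty$. Then for every $\eta>0$ there is a constant $\tilde c_\eta>0$, depending only on $\eta$ and on the weight sequence $\boldsymbol\gamma$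 (not on $b,\alpha,s,m,p,q^*$), such that for all $b,\alpha,s,m,p,q^*$ as above $$c_{s,\alpha,\boldsymbol\gamma,2\alpha}\le\tilde c_\eta\,s^{\frac{A+\eta}{b^{2\alpha}-1}}\qquad\text{and}\qquad B(\psi(q^*),\alpha,\boldsymbol\gamma)\le\tilde c_\eta\,s^{1+\frac{A+\eta}{b^{2\alpha}-1}}\,(N-1)^{-1},$$ so that the bound depends only polynomially on the dimension $s$. -/

import Mathlib

open Polynomial

noncomputable section

namespace KorobovPLR

/-- The polynomial `tr_m(k)(x) = k_0 + k_1 x + ⋯ + k_{m-1} x^{m-1}` over `ℤ_b` associated with the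
first `m` digits of the `b`-adic expansion `k = k_0 + k_1 b + ⋯`. -/
def trPoly (b m k : ℕ) : (ZMod b)[X] :=
  ∑ i ∈ Finset.range m, C ((k / b ^ i % b : ℕ) : ZMod b) * X ^ i

/-- The dual polynomial lattice of the generating vector `q` with modulus `p`, `m = deg p`:
all `k ∈ ℕ₀^s` with `tr_m(k_1) q_1 + ⋯ + tr_m(k_s) q_s ≡ 0 (mod p)`. -/
def dualLattice {b s : ℕ} (p : (ZMod b)[X]) (q : Fin s → (ZMod b)[X]) : Set (Fin s → ℕ) :=
  {k | p ∣ ∑ j, trPoly b p.natDegree (k j) * q j}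

/-- `r_{β,g}(k)` in base `b`: it is `1` for `k = 0`, and `g · b / ((b - 1) b^{β a})` for `k > 0`,
where `a` is the number of digits of `k` in base `b`. -/
def rOne (b : ℕ) (β g : ℝ) (k : ℕ) : ℝ :=
  if k = 0 then 1
  else g * ((b : ℝ) / (((b : ℝ) - 1) * (b : ℝ) ^ (β * ((Nat.digits b k).length : ℝ))))

/-- `r_{β,γ}(k) = ∏_j r_{β,γ_j}(k_j)`. The weight sequence is indexed from `0`, so `γ j` is the
weight of the `(j+1)`-st coordinate. -/
def rProd (b : ℕ) {s : ℕ} (β : ℝ) (γ : ℕ → ℝ) (k : Fin s → ℕ) : ℝ :=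
  ∏ j : Fin s, rOne b β (γ j) (k j)

/-- The quality criterion `B(q, α, γ)`: the sum of `r_{2α+1,γ}(k)` over all nonzero `k` in the dual
polynomial lattice. It is a sum of nonnegative terms, taken in `[0, ∞]`. -/
def B {b s : ℕ} (p : (ZMod b)[X]) (q : Fin s → (ZMod b)[X]) (α : ℝ) (γ : ℕ → ℝ) : ENNReal :=
  ∑' k : ↥(dualLattice p q \ {0}), ENNReal.ofReal (rProd b (2 * α + 1) γ k.1)

/-- `R_{b,m}`: the nonzero polynomials over `ℤ_b` of degree less than `m`. -/
def R (b m : ℕ) : Set (ZMod b)[X] :=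
  {q | q ≠ 0 ∧ q.natDegree < m}

/-- The Korobov generating vector `ψ(q) = (1, q, …, q^{s-1}) (mod p)`. -/
def korobovVec {b : ℕ} [Fact b.Prime] (s : ℕ) (p q : (ZMod b)[X]) : Fin s → (ZMod b)[X] :=
  fun j => q ^ (j : ℕ) % p

/-- `q` is a possible output of the Korobov construction with modulus `p`, `m = deg p`: it minimises
`B(ψ(·), α, γ)` over `R_{b,m}`. -/
def IsKorobovMinimizer {b : ℕ} [Fact b.Prime] (s : ℕ) (p : (ZMod b)[X]) (α : ℝ) (γ : ℕ → ℝ)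
    (q : (ZMod b)[X]) : Prop :=
  q ∈ R b p.natDegree ∧
    IsMinOn (fun q' => B p (korobovVec s p q') α γ) (R b p.natDegree) q

/-- `C_{b,α,l} = max(1 / (b^{2α} - 1)^l, (b - 1)^{1-l} / (b^{2αl} - b^{1-l}))`. -/
def Cconst (b : ℕ) (α l : ℝ) : ℝ :=
  max (1 / ((b : ℝ) ^ (2 * α) - 1) ^ l)
    (((b : ℝ) - 1) ^ (1 - l) / ((b : ℝ) ^ (2 * α * l) - (b : ℝ) ^ (1 - l)))

/-- `c_{s,α,γ,δ} = ∏_{j=1}^s (1 + γ_j^{1/(2α+1-δ)} C_{b,α,1/(2α+1-δ)})^{2α+1-δ}`. -/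
def cConst (b s : ℕ) (α : ℝ) (γ : ℕ → ℝ) (δ : ℝ) : ℝ :=
  ∏ j ∈ Finset.range s,
    (1 + γ j ^ (1 / (2 * α + 1 - δ)) * Cconst b α (1 / (2 * α + 1 - δ))) ^ (2 * α + 1 - δ)

end KorobovPLR

end

noncomputable section

namespace KorobovPLR

open scoped ENNReal

/-! ### Sums in `[0, ∞]` -/

/-! An averaging argument. Put `l = 1 / (2α+1-δ)`, so that `l ≤ 1` and, as `δ > 0`, `(2α+1) l > 1`.
Subadditivity of `x ↦ x ^ l` bounds `B ^ l` by the sum of the `l`-th powers of its terms, and a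
minimiser does no worse than the mean over the `N - 1` elements of `R`. After exchanging sums, each
`k` is weighted by the number of `q` whose dual lattice contains it. If some `k_j` is not divisible
by `N = b^m`, such `q` are roots of a nonzero polynomial of degree at most `s - 1` over the field
`ℤ_b[x]/(p)` (`ncard_dual_le`). If `N` divides every `k_j`, all `q` may count, but scaling a nonzero
vector by `N` costs a factor `1/N` (`ofReal_rProd_pow_mul_le`). Together these give `s` times the
sum over all `k`, which factors into geometric series.

For the second part, `δ = 2α` turns the constant into `∏ (1 + γ_j y)` with `y = 1 / (b^{2α} - 1)`.
For large `s`, `1 + x ≤ exp x` and the limsup suffice; small `s` needs a bound uniform in the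
unbounded `y` (`prod_one_add_mul_le_pow_mul_exp`). -/

theorem ennreal_finset_sum_rpow_le {ι : Type*} (s : Finset ι) (f : ι → ℝ≥0∞) {l : ℝ} (h0 : 0 < l)
    (h1 : l ≤ 1) : (∑ i ∈ s, f i) ^ l ≤ ∑ i ∈ s, f i ^ l := by
  classical
  induction s using Finset.induction_on with
  | empty => simp [h0]
  | insert a s ha ih =>
    rw [Finset.sum_insert ha, Finset.sum_insert ha]
    exact (ENNReal.rpow_add_le_add_rpow _ _ h0.le h1).trans (add_le_add le_rfl ih)

theorem ennreal_tsum_rpow_le {ι : Type*} (f : ι → ℝ≥0∞) {l : ℝ} (h0 : 0 < l) (h1 : l ≤ 1) :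
    (∑' i, f i) ^ l ≤ ∑' i, f i ^ l := by
  rw [← ENNReal.le_rpow_inv_iff h0, ENNReal.tsum_eq_iSup_sum]
  refine iSup_le fun s => ?_
  rw [ENNReal.le_rpow_inv_iff h0]
  exact (ennreal_finset_sum_rpow_le s f h0 h1).trans (ENNReal.sum_le_tsum s)

theorem ennreal_tsum_prod_fin {s : ℕ} (f : Fin s → ℕ → ℝ≥0∞) :
    ∑' k : Fin s → ℕ, ∏ j, f j (k j) = ∏ j, ∑' n, f j n := by
  induction s with
  | zero => simp
  | succ s ih =>
    rw [Fin.prod_univ_succ, ← ih, ← (Fin.consEquiv fun _ => ℕ).tsum_eq, ENNReal.tsum_prod',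
      ← ENNReal.tsum_mul_right]
    refine tsum_congr fun n => ?_
    rw [← ENNReal.tsum_mul_left]
    refine tsum_congr fun k => ?_
    simp [Fin.consEquiv, Fin.prod_univ_succ]

/-! ### The one-dimensional weights -/

theorem rOne_nonneg {b : ℕ} (hb : 1 < b) (β : ℝ) {g : ℝ} (hg : 0 < g) (k : ℕ) :
    0 ≤ rOne b β g k := by
  have : (0 : ℝ) < b - 1 := sub_pos.2 (by exact_mod_cast hb)
  unfold rOne
  split_ifs <;> positivity

theorem rOne_rpow_of_mem_Ico {b : ℕ} (hb : 1 < b) (β l : ℝ) {g : ℝ} (hg : 0 < g) {a k : ℕ}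
    (hk : k ∈ Finset.Ico (b ^ a) (b ^ (a + 1))) :
    rOne b β g k ^ l =
      g ^ l * ((b : ℝ) / (b - 1)) ^ l * (b : ℝ) ^ (-(β * l)) * ((b : ℝ) ^ (-(β * l))) ^ a := by
  have hb' : (1 : ℝ) < b := by exact_mod_cast hb
  have hb1 : (0 : ℝ) < b - 1 := sub_pos.2 hb'
  have hb0 : (0 : ℝ) < b := by linarith
  rw [Finset.mem_Ico] at hk
  have hk0 : k ≠ 0 := (lt_of_lt_of_le (by positivity) hk.1).ne'
  have hlen : (Nat.digits b k).length = a + 1 :=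
    le_antisymm ((Nat.digits_length_le_iff hb k).2 hk.2) ((Nat.lt_digits_length_iff hb k).2 hk.1)
  have h1 : g * ((b : ℝ) / ((b - 1) * (b : ℝ) ^ (β * ((a + 1 : ℕ) : ℝ))))
      = g * ((b : ℝ) / (b - 1)) * (b : ℝ) ^ (-(β * ((a + 1 : ℕ) : ℝ))) := by
    rw [Real.rpow_neg hb0.le]
    field_simp
  rw [rOne, if_neg hk0, hlen, h1, Real.mul_rpow (by positivity) (by positivity),
    Real.mul_rpow (by positivity) (by positivity), mul_assoc (g ^ l * _), ← Real.rpow_mul hb0.le,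
    ← pow_succ', ← Real.rpow_natCast, ← Real.rpow_mul hb0.le]
  congr 2
  ring

theorem sum_rOne_rpow_range_pow {b : ℕ} (hb : 1 < b) (β l : ℝ) {g : ℝ} (hg : 0 < g) (n : ℕ) :
    ∑ k ∈ Finset.range (b ^ n), rOne b β g k ^ l =
      1 + g ^ l * ((b : ℝ) / (b - 1)) ^ l * (b : ℝ) ^ (-(β * l)) * (b - 1) *
        ∑ a ∈ Finset.range n, ((b : ℝ) * (b : ℝ) ^ (-(β * l))) ^ a := by
  induction n with
  | zero => simp [rOne]
  | succ n ih =>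
    have hle : b ^ n ≤ b ^ (n + 1) := Nat.pow_le_pow_right (by omega) (by omega)
    rw [← Finset.sum_range_add_sum_Ico _ hle, ih,
      Finset.sum_congr rfl fun k hk => rOne_rpow_of_mem_Ico hb β l hg hk, Finset.sum_const,
      Nat.card_Ico, nsmul_eq_mul, Nat.cast_sub hle, Finset.sum_range_succ, mul_pow]
    push_cast
    ring

/-- The two fractions differ by the common factor `b^l * b^{-(2α+1)l} = b^{-2αl}`. -/
theorem geometric_eq_Cconst {b : ℕ} (hb : 1 < b) {α l : ℝ} :
    ((b : ℝ) / (b - 1)) ^ l * (b : ℝ) ^ (-((2 * α + 1) * l)) * (b - 1) *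
        (1 - (b : ℝ) * (b : ℝ) ^ (-((2 * α + 1) * l)))⁻¹ =
      ((b : ℝ) - 1) ^ (1 - l) / ((b : ℝ) ^ (2 * α * l) - (b : ℝ) ^ (1 - l)) := by
  have hb' : (1 : ℝ) < b := by exact_mod_cast hb
  have hb1 : (0 : ℝ) < b - 1 := sub_pos.2 hb'
  have hb0 : (0 : ℝ) < b := by linarith
  have hx : (0 : ℝ) < (b : ℝ) ^ l * (b : ℝ) ^ (-((2 * α + 1) * l)) := by positivity
  rw [Real.div_rpow hb0.le hb1.le, ← mul_div_mul_right (((b : ℝ) - 1) ^ (1 - l)) _ hx.ne',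
    div_eq_mul_inv (((b : ℝ) - 1) ^ (1 - l) * _)]
  congr 1
  · rw [Real.rpow_sub hb1, Real.rpow_one]
    ring
  · congr 1
    rw [sub_mul, ← mul_assoc ((b : ℝ) ^ (1 - l)), ← Real.rpow_add hb0, ← Real.rpow_add hb0,
      ← Real.rpow_add hb0, show 1 - l + l = 1 by ring, Real.rpow_one,
      show 2 * α * l + (l + -((2 * α + 1) * l)) = 0 by ring, Real.rpow_zero]

/-- There are `(b-1) b^a` integers with `a+1` digits, so grouping by length gives a geometric series
of ratio `b^{1-(2α+1)l} < 1`. Only the second entry of the maximum in `Cconst` is needed. -/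
theorem sum_rOne_rpow_range_le {b : ℕ} (hb : 1 < b) {α l : ℝ} (hl : 1 < (2 * α + 1) * l) {g : ℝ}
    (hg : 0 < g) (n : ℕ) :
    ∑ k ∈ Finset.range n, rOne b (2 * α + 1) g k ^ l ≤ 1 + g ^ l * Cconst b α l := by
  have hb' : (1 : ℝ) < b := by exact_mod_cast hb
  have hb1 : (0 : ℝ) < b - 1 := sub_pos.2 hb'
  have hb0 : (0 : ℝ) < b := by linarith
  have hx0 : 0 ≤ (b : ℝ) * (b : ℝ) ^ (-((2 * α + 1) * l)) := by positivity
  have hx1 : (b : ℝ) * (b : ℝ) ^ (-((2 * α + 1) * l)) < 1 := by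
    rw [← Real.rpow_one_add' hb0.le (by linarith)]
    exact Real.rpow_lt_one_of_one_lt_of_neg hb' (by linarith)
  calc ∑ k ∈ Finset.range n, rOne b (2 * α + 1) g k ^ l
      ≤ ∑ k ∈ Finset.range (b ^ n), rOne b (2 * α + 1) g k ^ l :=
        Finset.sum_le_sum_of_subset_of_nonneg
          (Finset.range_subset_range.2 (Nat.lt_pow_self hb).le)
          fun k _ _ => Real.rpow_nonneg (rOne_nonneg hb _ hg k) _
    _ ≤ 1 + g ^ l * ((b : ℝ) / (b - 1)) ^ l * (b : ℝ) ^ (-((2 * α + 1) * l)) * (b - 1) *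
        (1 - (b : ℝ) * (b : ℝ) ^ (-((2 * α + 1) * l)))⁻¹ := by
      rw [sum_rOne_rpow_range_pow hb _ _ hg]
      gcongr
      rw [← tsum_geometric_of_lt_one hx0 hx1]
      exact (summable_geometric_of_lt_one hx0 hx1).sum_le_tsum _ fun _ _ => by positivity
    _ = 1 + g ^ l * (((b : ℝ) - 1) ^ (1 - l) / ((b : ℝ) ^ (2 * α * l) - (b : ℝ) ^ (1 - l))) := by
      rw [← geometric_eq_Cconst hb]
      ring
    _ ≤ 1 + g ^ l * Cconst b α l := by
      gcongr
      exact le_max_right _ _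

theorem tsum_rOne_rpow_le {b : ℕ} (hb : 1 < b) {α l : ℝ} (hl0 : 0 ≤ l) (hl : 1 < (2 * α + 1) * l)
    {g : ℝ} (hg : 0 < g) :
    ∑' k : ℕ, ENNReal.ofReal (rOne b (2 * α + 1) g k) ^ l ≤
      ENNReal.ofReal (1 + g ^ l * Cconst b α l) := by
  refine ENNReal.tsum_le_of_sum_range_le fun n => ?_
  rw [Finset.sum_congr rfl fun k _ => ENNReal.ofReal_rpow_of_nonneg (rOne_nonneg hb _ hg k) hl0,
    ← ENNReal.ofReal_sum_of_nonneg fun k _ => Real.rpow_nonneg (rOne_nonneg hb _ hg k) _]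
  exact ENNReal.ofReal_le_ofReal (sum_rOne_rpow_range_le hb hl hg n)

theorem rOne_pow_mul {b : ℕ} (hb : 1 < b) (β g : ℝ) (m : ℕ) {k : ℕ} (hk : k ≠ 0) :
    rOne b β g (b ^ m * k) = (b : ℝ) ^ (-(β * m)) * rOne b β g k := by
  have hb' : (1 : ℝ) < b := by exact_mod_cast hb
  have hb1 : (b : ℝ) - 1 ≠ 0 := (sub_pos.2 hb').ne'
  have hb0 : (0 : ℝ) < b := by linarith
  rw [rOne, rOne, if_neg hk, if_neg (by positivity), Nat.digits_base_pow_mul hb (by omega),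
    List.length_append, List.length_replicate, Nat.cast_add, mul_add, Real.rpow_add hb0,
    Real.rpow_neg hb0.le]
  field_simp

theorem ofReal_rOne_pow_mul_le {b : ℕ} (hb : 1 < b) {β l : ℝ} (hl0 : 0 ≤ l) (hl : 1 < β * l)
    (g : ℝ) (m : ℕ) {k : ℕ} (hk : k ≠ 0) :
    ENNReal.ofReal (rOne b β g (b ^ m * k)) ^ l ≤
      ((b : ℝ≥0∞) ^ m)⁻¹ * ENNReal.ofReal (rOne b β g k) ^ l := by
  have hb' : (1 : ℝ) < b := by exact_mod_cast hb
  have hb0 : (0 : ℝ) < b := by linarith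
  rw [rOne_pow_mul hb β g m hk, ENNReal.ofReal_mul (by positivity),
    ENNReal.mul_rpow_of_nonneg _ _ hl0]
  gcongr
  rw [ENNReal.ofReal_rpow_of_nonneg (by positivity) hl0, ← Real.rpow_mul hb0.le]
  calc ENNReal.ofReal ((b : ℝ) ^ (-(β * m) * l)) ≤ ENNReal.ofReal (((b : ℝ) ^ m)⁻¹) := by
        apply ENNReal.ofReal_le_ofReal
        rw [← Real.rpow_natCast, ← Real.rpow_neg hb0.le]
        apply Real.rpow_le_rpow_of_exponent_le hb'.le
        nlinarith [Nat.cast_nonneg (α := ℝ) m]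
    _ = ((b : ℝ≥0∞) ^ m)⁻¹ := by
        rw [ENNReal.ofReal_inv_of_pos (by positivity), ENNReal.ofReal_pow hb0.le,
          ENNReal.ofReal_natCast]

/-! ### The product weights -/

theorem ofReal_rProd_rpow {b s : ℕ} (hb : 1 < b) (β : ℝ) {l : ℝ} (hl0 : 0 ≤ l) {γ : ℕ → ℝ}
    (hγ : ∀ j, 0 < γ j) (k : Fin s → ℕ) :
    ENNReal.ofReal (rProd b β γ k) ^ l = ∏ j : Fin s, ENNReal.ofReal (rOne b β (γ j) (k j)) ^ l := by
  rw [rProd, ENNReal.ofReal_prod_of_nonneg fun (j : Fin s) _ => rOne_nonneg hb β (hγ j) (k j),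
    ENNReal.prod_rpow_of_nonneg hl0]

theorem tsum_ofReal_rProd_rpow_le {b : ℕ} (s : ℕ) (hb : 1 < b) {α l : ℝ} (hl0 : 0 ≤ l)
    (hl : 1 < (2 * α + 1) * l) {γ : ℕ → ℝ} (hγ : ∀ j, 0 < γ j) :
    ∑' k : Fin s → ℕ, ENNReal.ofReal (rProd b (2 * α + 1) γ k) ^ l ≤
      ∏ j : Fin s, ENNReal.ofReal (1 + γ j ^ l * Cconst b α l) := by
  rw [tsum_congr fun k => ofReal_rProd_rpow hb _ hl0 hγ k,
    ennreal_tsum_prod_fin fun (j : Fin s) n => ENNReal.ofReal (rOne b (2 * α + 1) (γ j) n) ^ l]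
  exact Finset.prod_le_prod' fun j _ => tsum_rOne_rpow_le hb hl0 hl (hγ j)

/-- A single nonzero coordinate already supplies the factor `b^{-m}`; scaling the others cannot
increase their weight. -/
theorem ofReal_rProd_pow_mul_le {b s : ℕ} (hb : 1 < b) {β l : ℝ} (hl0 : 0 ≤ l) (hl : 1 < β * l)
    {γ : ℕ → ℝ} (hγ : ∀ j, 0 < γ j) (m : ℕ) {k : Fin s → ℕ} (hk : k ≠ 0) :
    ENNReal.ofReal (rProd b β γ fun j => b ^ m * k j) ^ l ≤
      ((b : ℝ≥0∞) ^ m)⁻¹ * ENNReal.ofReal (rProd b β γ k) ^ l := by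
  obtain ⟨i, hi⟩ := Function.ne_iff.1 hk
  rw [ofReal_rProd_rpow hb β hl0 hγ, ofReal_rProd_rpow hb β hl0 hγ,
    ← Finset.mul_prod_erase _ _ (Finset.mem_univ i), ← Finset.mul_prod_erase _ _ (Finset.mem_univ i),
    ← mul_assoc]
  refine mul_le_mul' (ofReal_rOne_pow_mul_le hb hl0 hl (γ i) m hi)
    (Finset.prod_le_prod' fun j _ => ?_)
  rcases eq_or_ne (k j) 0 with h0 | h0
  · simp [h0]
  · refine (ofReal_rOne_pow_mul_le hb hl0 hl (γ j) m h0).trans (mul_le_of_le_one_left' ?_)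
    rw [ENNReal.inv_le_one]
    exact one_le_pow₀ (by exact_mod_cast hb.le)

end KorobovPLR

end

noncomputable section

namespace KorobovPLR

open scoped ENNReal

/-! ### Counting the admissible generating polynomials -/

theorem R_eq_degreeLT_diff (b m : ℕ) :
    R b m = (degreeLT (ZMod b) m : Set (ZMod b)[X]) \ {0} := by
  ext q
  simp only [R, Set.mem_ofPred_eq, Set.mem_sdiff, SetLike.mem_coe, mem_degreeLT,
    Set.mem_singleton_iff]
  constructor
  · rintro ⟨h0, h⟩
    exact ⟨(natDegree_lt_iff_degree_lt h0).1 h, h0⟩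
  · rintro ⟨h, h0⟩
    exact ⟨h0, (natDegree_lt_iff_degree_lt h0).2 h⟩

theorem R_finite (b m : ℕ) [NeZero b] : (R b m).Finite := by
  rw [R_eq_degreeLT_diff]
  have : Finite (degreeLT (ZMod b) m) := Finite.of_equiv _ (degreeLTEquiv (ZMod b) m).symm.toEquiv
  exact (Set.toFinite (degreeLT (ZMod b) m : Set (ZMod b)[X])).sdiff

theorem R_ncard (b m : ℕ) [NeZero b] : (R b m).ncard = b ^ m - 1 := by
  rw [R_eq_degreeLT_diff, Set.ncard_sdiff_singleton_of_mem (Submodule.zero_mem _)]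
  congr 1
  rw [← Nat.card_coe_set_eq]
  exact (Nat.card_congr (degreeLTEquiv (ZMod b) m).toEquiv).trans (by simp)

theorem coeff_trPoly (b m k i : ℕ) :
    (trPoly b m k).coeff i = if i < m then ((k / b ^ i % b : ℕ) : ZMod b) else 0 := by
  simp [trPoly, coeff_X_pow]

theorem degree_trPoly_lt (b m k : ℕ) : (trPoly b m k).degree < m := by
  rw [degree_lt_iff_coeff_zero]
  intro i hi
  rw [coeff_trPoly, if_neg (by omega)]

theorem pow_dvd_of_trPoly_eq_zero {b m k : ℕ} (h : trPoly b m k = 0) : b ^ m ∣ k := by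
  have hd : ∀ i < m, b ∣ k / b ^ i := fun i hi => by
    have := coeff_trPoly b m k i
    rwa [h, if_pos hi, coeff_zero, eq_comm, ZMod.natCast_mod, ZMod.natCast_eq_zero_iff] at this
  have key : ∀ i ≤ m, b ^ i ∣ k := by
    intro i
    induction i with
    | zero => simp
    | succ i ih =>
      intro hi
      rw [pow_succ]
      exact Nat.mul_dvd_of_dvd_div (ih (by omega)) (hd i (by omega))
  exact key m le_rfl

theorem ncard_dual_le {b : ℕ} [Fact b.Prime] {s : ℕ} {p : (ZMod b)[X]} (hp : Irreducible p)
    {k : Fin s → ℕ} (hk : ∃ j, ¬ b ^ p.natDegree ∣ k j) :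
    {q ∈ R b p.natDegree | k ∈ dualLattice p (korobovVec s p q)}.ncard ≤ s - 1 := by
  have : Fact (Irreducible p) := ⟨hp⟩
  obtain ⟨j₀, hj₀⟩ := hk
  -- Since the generating vector consists of powers of `q`, membership of `k` in the dual lattice
  -- says that the class of `q` is a root of `P`.
  let P : (AdjoinRoot p)[X] :=
    ∑ j : Fin s, C (AdjoinRoot.mk p (trPoly b p.natDegree (k j))) * X ^ (j : ℕ)
  have hcoeff : P.coeff j₀ = AdjoinRoot.mk p (trPoly b p.natDegree (k j₀)) := by
    simp [P, coeff_C_mul, coeff_X_pow, Fin.val_inj]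
  have hP0 : P ≠ 0 := by
    intro h0
    rw [h0, coeff_zero, eq_comm, AdjoinRoot.mk_eq_zero] at hcoeff
    refine hj₀ (pow_dvd_of_trPoly_eq_zero (eq_zero_of_dvd_of_degree_lt hcoeff ?_))
    rw [degree_eq_natDegree hp.ne_zero]
    exact degree_trPoly_lt _ _ _
  have hdeg : P.natDegree ≤ s - 1 := by
    refine natDegree_sum_le_of_forall_le _ _ fun j _ => ?_
    exact (natDegree_C_mul_X_pow_le _ _).trans (by omega)
  have hmaps : ∀ q ∈ {q ∈ R b p.natDegree | k ∈ dualLattice p (korobovVec s p q)},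
      AdjoinRoot.mk p q ∈ (P.roots.toFinset : Set (AdjoinRoot p)) := by
    rintro q ⟨-, hq⟩
    rw [Finset.mem_coe, Multiset.mem_toFinset, mem_roots hP0, IsRoot.def]
    have hq' := AdjoinRoot.mk_eq_zero.2 hq
    rw [map_sum] at hq'
    rw [eval_finsetSum, ← hq']
    refine Finset.sum_congr rfl fun j _ => ?_
    rw [eval_mul, eval_C, eval_pow, eval_X, map_mul, ← map_pow]
    congr 1
    rw [AdjoinRoot.mk_eq_mk, korobovVec]
    exact dvd_sub_comm.1 (EuclideanDomain.mod_eq_sub_mul_div (q ^ (j : ℕ)) p ▸ by simp)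
  -- Distinct polynomials of degree below `deg p` have distinct classes, so counting roots counts
  -- `q`.
  have hinj : Set.InjOn (AdjoinRoot.mk p)
      {q ∈ R b p.natDegree | k ∈ dualLattice p (korobovVec s p q)} := by
    rintro q ⟨hq, -⟩ q' ⟨hq', -⟩ h
    rw [R_eq_degreeLT_diff] at hq hq'
    rw [AdjoinRoot.mk_eq_mk] at h
    refine sub_eq_zero.1 (eq_zero_of_dvd_of_degree_lt h ?_)
    rw [degree_eq_natDegree hp.ne_zero]
    exact mem_degreeLT.1 (Submodule.sub_mem _ hq.1 hq'.1)
  calc _ ≤ (P.roots.toFinset : Set (AdjoinRoot p)).ncard :=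
        Set.ncard_le_ncard_of_injOn _ hmaps hinj
    _ = P.roots.toFinset.card := Set.ncard_coe_finset _
    _ ≤ P.roots.card := Multiset.toFinset_card_le _
    _ ≤ s - 1 := (card_roots' P).trans hdeg

end KorobovPLR

end

noncomputable section

namespace KorobovPLR

open scoped ENNReal

/-! ### Averaging over the admissible generating polynomials -/

theorem B_rpow_le {b s : ℕ} (p : (ZMod b)[X]) (q : Fin s → (ZMod b)[X]) (α : ℝ) (γ : ℕ → ℝ)
    {l : ℝ} (h0 : 0 < l) (h1 : l ≤ 1) :
    B p q α γ ^ l ≤ ∑' k : Fin s → ℕ, (dualLattice p q \ {0}).indicator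
      (fun k => ENNReal.ofReal (rProd b (2 * α + 1) γ k) ^ l) k := by
  rw [← tsum_subtype]
  exact ennreal_tsum_rpow_le _ h0 h1

theorem tsum_indicator_multiples_le {b s : ℕ} (hb : 1 < b) {β l : ℝ} (hl0 : 0 ≤ l)
    (hl : 1 < β * l) {γ : ℕ → ℝ} (hγ : ∀ j, 0 < γ j) (m : ℕ) :
    ∑' k : Fin s → ℕ, {k : Fin s → ℕ | k ≠ 0 ∧ ∀ j, b ^ m ∣ k j}.indicator
        (fun k => ENNReal.ofReal (rProd b β γ k) ^ l) k ≤
      ((b : ℝ≥0∞) ^ m)⁻¹ * ∑' k : Fin s → ℕ, ENNReal.ofReal (rProd b β γ k) ^ l := by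
  have hbm : b ^ m ≠ 0 := by positivity
  have hinj : Function.Injective fun (k : Fin s → ℕ) (j : Fin s) => b ^ m * k j := by
    intro k k' h
    funext j
    exact Nat.eq_of_mul_eq_mul_left (Nat.pos_of_ne_zero hbm) (congrFun h j)
  rw [← hinj.tsum_eq, ← ENNReal.tsum_mul_left]
  · refine ENNReal.tsum_le_tsum fun k => Set.indicator_apply_le' (fun hk => ?_) fun _ => zero_le
    refine ofReal_rProd_pow_mul_le hb hl0 hl hγ m ?_
    rintro rfl
    exact hk.1 (by ext; simp)
  · refine Set.support_indicator_subset.trans fun k hk => ⟨fun j => k j / b ^ m, ?_⟩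
    funext j
    exact Nat.mul_div_cancel' (hk.2 j)

theorem sum_indicator_dual_le {b : ℕ} [Fact b.Prime] {s : ℕ} {p : (ZMod b)[X]} (hp : Irreducible p)
    (f : (Fin s → ℕ) → ℝ≥0∞) (k : Fin s → ℕ) :
    ∑ q ∈ (R_finite b p.natDegree).toFinset,
        (dualLattice p (korobovVec s p q) \ {0}).indicator f k ≤
      (s - 1 : ℕ) * f k + (b ^ p.natDegree - 1 : ℕ) *
        {k : Fin s → ℕ | k ≠ 0 ∧ ∀ j, b ^ p.natDegree ∣ k j}.indicator f k := by
  classical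
  have hcard : (R_finite b p.natDegree).toFinset.card = b ^ p.natDegree - 1 := by
    rw [← R_ncard, Set.ncard_eq_toFinset_card _ (R_finite b p.natDegree)]
  by_cases hk0 : k = 0
  · simp [hk0]
  by_cases hk : ∀ j, b ^ p.natDegree ∣ k j
  · rw [Set.indicator_of_mem (show k ∈ {k : Fin s → ℕ | k ≠ 0 ∧ ∀ j, b ^ p.natDegree ∣ k j} from
      ⟨hk0, hk⟩)]
    refine le_trans ?_ le_add_self
    rw [← hcard, ← nsmul_eq_mul]
    exact Finset.sum_le_card_nsmul _ _ _ fun q _ => Set.indicator_le_self _ _ _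
  · push Not at hk
    refine le_trans ?_ le_self_add
    simp only [Set.indicator_apply]
    rw [← Finset.sum_filter, Finset.sum_const, nsmul_eq_mul]
    gcongr
    refine le_trans ?_ (ncard_dual_le hp hk)
    rw [← Set.ncard_coe_finset]
    refine Set.ncard_le_ncard (fun q hq => ?_) ((R_finite b p.natDegree).subset fun q hq => hq.1)
    simp only [Finset.coe_filter, Set.Finite.mem_toFinset, Set.mem_ofPred_eq] at hq
    exact ⟨hq.1, hq.2.1⟩

theorem card_mul_B_rpow_le {b : ℕ} [Fact b.Prime] {s : ℕ} (hs : 1 ≤ s) {p : (ZMod b)[X]}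
    (hp : Irreducible p) {α l : ℝ} (h0 : 0 < l) (h1 : l ≤ 1) (hl : 1 < (2 * α + 1) * l)
    {γ : ℕ → ℝ} (hγ : ∀ j, 0 < γ j) {q : (ZMod b)[X]} (hq : IsKorobovMinimizer s p α γ q) :
    (b ^ p.natDegree - 1 : ℕ) * B p (korobovVec s p q) α γ ^ l ≤
      s * ∏ j : Fin s, ENNReal.ofReal (1 + γ j ^ l * Cconst b α l) := by
  have hb : 1 < b := (Fact.out : b.Prime).one_lt
  set f : (Fin s → ℕ) → ℝ≥0∞ := fun k => ENNReal.ofReal (rProd b (2 * α + 1) γ k) ^ l with hf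
  have hcard : (R_finite b p.natDegree).toFinset.card = b ^ p.natDegree - 1 := by
    rw [← R_ncard, Set.ncard_eq_toFinset_card _ (R_finite b p.natDegree)]
  have hN : ((b ^ p.natDegree - 1 : ℕ) : ℝ≥0∞) * ((b : ℝ≥0∞) ^ p.natDegree)⁻¹ ≤ 1 := by
    rw [← div_eq_mul_inv]
    refine ENNReal.div_le_of_le_mul ?_
    rw [one_mul]
    exact_mod_cast Nat.sub_le _ _
  calc (b ^ p.natDegree - 1 : ℕ) * B p (korobovVec s p q) α γ ^ l
      = ∑ q' ∈ (R_finite b p.natDegree).toFinset, B p (korobovVec s p q) α γ ^ l := by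
        rw [Finset.sum_const, hcard, nsmul_eq_mul]
    _ ≤ ∑ q' ∈ (R_finite b p.natDegree).toFinset,
          ∑' k, (dualLattice p (korobovVec s p q') \ {0}).indicator f k := by
        refine Finset.sum_le_sum fun q' hq' => le_trans ?_ (B_rpow_le p _ α γ h0 h1)
        exact ENNReal.rpow_le_rpow (hq.2 ((R_finite b p.natDegree).mem_toFinset.1 hq')) h0.le
    _ = ∑' k, ∑ q' ∈ (R_finite b p.natDegree).toFinset,
          (dualLattice p (korobovVec s p q') \ {0}).indicator f k :=
        (Summable.tsum_finsetSum fun _ _ => ENNReal.summable).symm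
    _ ≤ ∑' k, ((s - 1 : ℕ) * f k + (b ^ p.natDegree - 1 : ℕ) *
          {k : Fin s → ℕ | k ≠ 0 ∧ ∀ j, b ^ p.natDegree ∣ k j}.indicator f k) :=
        ENNReal.tsum_le_tsum fun k => sum_indicator_dual_le hp f k
    _ ≤ (s - 1 : ℕ) * ∑' k, f k +
          (b ^ p.natDegree - 1 : ℕ) * (((b : ℝ≥0∞) ^ p.natDegree)⁻¹ * ∑' k, f k) := by
        rw [ENNReal.tsum_add, ENNReal.tsum_mul_left, ENNReal.tsum_mul_left]
        gcongr
        exact tsum_indicator_multiples_le hb h0.le hl hγ _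
    -- The multiples of `N` contribute at most `(N-1)/N ≤ 1`, raising the root count `s - 1` to `s`.
    _ ≤ (s - 1 : ℕ) * ∑' k, f k + 1 * ∑' k, f k := by
        rw [← mul_assoc]
        gcongr
    _ = s * ∑' k, f k := by
        rw [← add_mul]
        congr 1
        exact_mod_cast Nat.sub_add_cancel hs
    _ ≤ _ := by
        gcongr
        exact tsum_ofReal_rProd_rpow_le s hb h0.le hl hγ

theorem Cconst_nonneg {b : ℕ} (hb : 1 < b) {α : ℝ} (hα : 0 < α) (l : ℝ) : 0 ≤ Cconst b α l := by
  have : (1 : ℝ) ≤ (b : ℝ) ^ (2 * α) :=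
    Real.one_le_rpow (by exact_mod_cast hb.le) (by positivity)
  exact le_trans (div_nonneg zero_le_one (Real.rpow_nonneg (sub_nonneg.2 this) l)) (le_max_left _ _)

theorem B_korobov_le {b : ℕ} [Fact b.Prime] {α : ℝ} (hα : 0 < α) {s : ℕ} (hs : 1 ≤ s)
    {p : (ZMod b)[X]} (hp : Irreducible p) {γ : ℕ → ℝ} (hγ : ∀ j, 0 < γ j) {q : (ZMod b)[X]}
    (hq : IsKorobovMinimizer s p α γ q) {δ : ℝ} (hδ0 : 0 < δ) (hδ : δ ≤ 2 * α) :
    B p (korobovVec s p q) α γ ≤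
      ENNReal.ofReal (cConst b s α γ δ * (s : ℝ) ^ (2 * α + 1 - δ) *
        ((b : ℝ) ^ p.natDegree - 1) ^ (-(2 * α + 1) + δ)) := by
  have hb : 1 < b := (Fact.out : b.Prime).one_lt
  set t : ℝ := 2 * α + 1 - δ with ht
  have ht1 : 1 ≤ t := by linarith
  have ht0 : 0 < t := by linarith
  have hl0 : 0 < 1 / t := by positivity
  have hl1 : 1 / t ≤ 1 := by rwa [div_le_one ht0]
  have hl : 1 < (2 * α + 1) * (1 / t) := by
    rw [mul_one_div, one_lt_div ht0]
    linarith
  have hm : p.natDegree ≠ 0 := hp.natDegree_pos.ne'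
  have hN : (0 : ℝ) < (b : ℝ) ^ p.natDegree - 1 :=
    sub_pos.2 (one_lt_pow₀ (by exact_mod_cast hb) hm)
  have hfac : ∀ j, 0 ≤ 1 + γ j ^ (1 / t) * Cconst b α (1 / t) := fun j =>
    add_nonneg zero_le_one
      (mul_nonneg (Real.rpow_nonneg (hγ j).le _) (Cconst_nonneg hb hα _))
  have hprod : 0 ≤ ∏ j ∈ Finset.range s, (1 + γ j ^ (1 / t) * Cconst b α (1 / t)) :=
    Finset.prod_nonneg fun j _ => hfac j
  have hrhs : cConst b s α γ δ * (s : ℝ) ^ t * ((b : ℝ) ^ p.natDegree - 1) ^ (-(2 * α + 1) + δ) =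
      (s * (∏ j ∈ Finset.range s, (1 + γ j ^ (1 / t) * Cconst b α (1 / t))) /
        ((b : ℝ) ^ p.natDegree - 1)) ^ t := by
    rw [show -(2 * α + 1) + δ = -t by rw [ht]; ring, Real.rpow_neg hN.le,
      Real.div_rpow (by positivity) hN.le, Real.mul_rpow (by positivity) hprod,
      ← Real.finsetProd_rpow _ _ fun j _ => hfac j, cConst, ← ht]
    ring
  have hcast : ((b ^ p.natDegree - 1 : ℕ) : ℝ≥0∞) = ENNReal.ofReal ((b : ℝ) ^ p.natDegree - 1) := by
    rw [← ENNReal.ofReal_natCast, Nat.cast_sub (Nat.one_le_pow _ _ hb.le)]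
    simp
  have hmain := card_mul_B_rpow_le hs hp hl0 hl1 hl hγ hq
  rw [hrhs, ← ENNReal.ofReal_rpow_of_nonneg (by positivity) ht0.le, ← ENNReal.rpow_inv_le_iff ht0,
    ENNReal.ofReal_div_of_pos hN, ENNReal.le_div_iff_mul_le
      (Or.inl (ENNReal.ofReal_pos.2 hN).ne') (Or.inl ENNReal.ofReal_ne_top), mul_comm, ← hcast,
    ENNReal.ofReal_mul (by positivity), ENNReal.ofReal_natCast,
    ENNReal.ofReal_prod_of_nonneg fun j _ => hfac j, Finset.prod_range, ← one_div]
  exact hmain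

end KorobovPLR

end

noncomputable section

namespace KorobovPLR

/-! ### Polynomial dependence on the dimension -/

theorem cConst_two_mul (b s : ℕ) (α : ℝ) (γ : ℕ → ℝ) :
    cConst b s α γ (2 * α) = ∏ j ∈ Finset.range s, (1 + γ j * (1 / ((b : ℝ) ^ (2 * α) - 1))) := by
  simp [cConst, Cconst]

theorem prod_one_add_mul_le_exp (s : ℕ) {γ : ℕ → ℝ} (hγ : ∀ j, 0 < γ j) {y : ℝ} (hy : 0 ≤ y) :
    ∏ j ∈ Finset.range s, (1 + γ j * y) ≤ Real.exp ((∑ j ∈ Finset.range s, γ j) * y) := by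
  rw [Finset.sum_mul, Real.exp_sum]
  refine Finset.prod_le_prod (fun j _ => ?_) fun j _ => ?_
  · have := hγ j
    positivity
  · rw [add_comm]
    exact Real.add_one_le_exp _

/-- Linear growth in `y` is dominated by `exp (ε y)` for any `ε > 0`, at the price of a constant
independent of `y`. Hence finitely many factors cost an arbitrarily small exponent. -/
theorem prod_one_add_mul_le_pow_mul_exp {γ : ℕ → ℝ} (hγ : ∀ j, 0 < γ j) (hγ' : Antitone γ)
    {ε : ℝ} (hε : 0 < ε) {s n : ℕ} (hs : s ≤ n) {y : ℝ} (hy : 0 ≤ y) :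
    ∏ j ∈ Finset.range s, (1 + γ j * y) ≤ max 1 (γ 0 / ε) ^ n * Real.exp (n * ε * y) := by
  have hfac : ∀ j, 1 + γ j * y ≤ max 1 (γ 0 / ε) * Real.exp (ε * y) := by
    intro j
    calc 1 + γ j * y ≤ 1 + γ 0 * y := by
          gcongr
          exact hγ' (Nat.zero_le j)
      _ = 1 * 1 + γ 0 / ε * (ε * y) := by field_simp
      _ ≤ max 1 (γ 0 / ε) * 1 + max 1 (γ 0 / ε) * (ε * y) := by
          gcongr
          · exact le_max_left _ _
          · exact le_max_right _ _
      _ = max 1 (γ 0 / ε) * (ε * y + 1) := by ring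
      _ ≤ max 1 (γ 0 / ε) * Real.exp (ε * y) := by
          gcongr
          exact Real.add_one_le_exp _
  have hone : 1 ≤ max 1 (γ 0 / ε) * Real.exp (ε * y) :=
    one_le_mul_of_one_le_of_one_le (le_max_left _ _) (Real.one_le_exp (by positivity))
  calc ∏ j ∈ Finset.range s, (1 + γ j * y)
      ≤ ∏ j ∈ Finset.range s, (max 1 (γ 0 / ε) * Real.exp (ε * y)) :=
        Finset.prod_le_prod (fun j _ => by have := hγ j; positivity) fun j _ => hfac j
    _ = (max 1 (γ 0 / ε) * Real.exp (ε * y)) ^ s := by simp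
    _ ≤ (max 1 (γ 0 / ε) * Real.exp (ε * y)) ^ n := pow_le_pow_right₀ hone hs
    _ = max 1 (γ 0 / ε) ^ n * Real.exp (n * ε * y) := by
        rw [mul_pow, ← Real.exp_nat_mul, mul_assoc]

theorem exists_cConst_le {γ : ℕ → ℝ} (hγ : ∀ j, 0 < γ j) (hγ' : Antitone γ) {A : ℝ}
    (hA : Filter.limsup
      (fun s : ℕ => (((∑ j ∈ Finset.range s, γ j) / Real.log s : ℝ) : EReal)) Filter.atTop
        = (A : EReal)) {η : ℝ} (hη : 0 < η) :
    ∃ c : ℝ, 0 < c ∧ ∀ (b : ℕ), 1 < b → ∀ α : ℝ, 0 < α → ∀ s : ℕ, 2 ≤ s →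
      cConst b s α γ (2 * α) ≤ c * (s : ℝ) ^ ((A + η) / ((b : ℝ) ^ (2 * α) - 1)) := by
  have hA0 : 0 ≤ A := by
    rw [← EReal.coe_nonneg, ← hA]
    refine Filter.le_limsup_of_frequently_le (Filter.Frequently.of_forall fun s => ?_)
    rw [EReal.coe_nonneg]
    exact div_nonneg (Finset.sum_nonneg fun j _ => (hγ j).le) (Real.log_natCast_nonneg s)
  have hev : ∀ᶠ s : ℕ in Filter.atTop, (∑ j ∈ Finset.range s, γ j) / Real.log s < A + η := by
    have hlt : Filter.limsup
        (fun s : ℕ => (((∑ j ∈ Finset.range s, γ j) / Real.log s : ℝ) : EReal)) Filter.atTop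
          < ((A + η : ℝ) : EReal) := by
      rw [hA, EReal.coe_lt_coe_iff]
      linarith
    exact (Filter.eventually_lt_of_limsup_lt hlt).mono fun s hs => EReal.coe_lt_coe_iff.1 hs
  obtain ⟨n, hn⟩ := Filter.eventually_atTop.1 hev
  -- Chosen so that `n + 1` factors cost exponent `η log 2 * y`, at most `(A + η) log s * y` because
  -- `A ≥ 0` and `s ≥ 2`. Using `n + 1` avoids division by zero.
  set ε : ℝ := η * Real.log 2 / (n + 1) with hε
  have hlog2 : 0 < Real.log 2 := Real.log_pos one_lt_two
  have hε0 : 0 < ε := by positivity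
  have hc1 : 1 ≤ max 1 (γ 0 / ε) ^ (n + 1) := one_le_pow₀ (le_max_left _ _)
  refine ⟨max 1 (γ 0 / ε) ^ (n + 1), by positivity, fun b hb α hα s hs => ?_⟩
  have hx : (0 : ℝ) < (b : ℝ) ^ (2 * α) - 1 :=
    sub_pos.2 (Real.one_lt_rpow (by exact_mod_cast hb) (by positivity))
  have hy : 0 ≤ 1 / ((b : ℝ) ^ (2 * α) - 1) := by positivity
  have hs0 : (0 : ℝ) < s := by exact_mod_cast (by omega : 0 < s)
  have hlogs : Real.log 2 ≤ Real.log s := Real.log_le_log two_pos (by exact_mod_cast hs)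
  rw [cConst_two_mul, Real.rpow_def_of_pos hs0, div_eq_mul_one_div (A + η), ← mul_assoc]
  rcases le_total n s with hns | hsn
  · refine (prod_one_add_mul_le_exp s hγ hy).trans ((?_ : _ ≤ _).trans
      (le_mul_of_one_le_left (Real.exp_pos _).le hc1))
    have := (div_lt_iff₀ (hlog2.trans_le hlogs)).1 (hn s hns)
    gcongr
    linarith
  · refine (prod_one_add_mul_le_pow_mul_exp hγ hγ' hε0 (hsn.trans n.le_succ) hy).trans ?_
    have : (n.succ : ℝ) * ε = η * Real.log 2 := by
      rw [hε]
      push_cast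
      field_simp
    rw [this, mul_comm (Real.log s)]
    gcongr
    linarith

end KorobovPLR

end

theorem corollary5p2 (γ : ℕ → ℝ) (hγ_pos : ∀ j, 0 < γ j) (hγ_anti : Antitone γ) :
    (∀ (b : ℕ) [Fact b.Prime] (α : ℝ), 0 < α → α ≤ 1 →
      ∀ s : ℕ, 2 ≤ s → ∀ m : ℕ, 1 ≤ m →
      ∀ p : Polynomial (ZMod b), Irreducible p → p.natDegree = m →
      ∀ q : Polynomial (ZMod b), KorobovPLR.IsKorobovMinimizer s p α γ q →
      ∀ δ : ℝ, 0 < δ → δ ≤ 2 * α →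
        KorobovPLR.B p (KorobovPLR.korobovVec s p q) α γ ≤
          ENNReal.ofReal (KorobovPLR.cConst b s α γ δ * (s : ℝ) ^ (2 * α + 1 - δ) *
            ((b : ℝ) ^ m - 1) ^ (-(2 * α + 1) + δ))) ∧
    (∀ A : ℝ,
      Filter.limsup
        (fun s : ℕ => (((∑ j ∈ Finset.range s, γ j) / Real.log s : ℝ) : EReal)) Filter.atTop
          = (A : EReal) →
      ∀ η : ℝ, 0 < η → ∃ ctilde : ℝ, 0 < ctilde ∧
        ∀ (b : ℕ) [Fact b.Prime] (α : ℝ), 0 < α → α ≤ 1 → ∀ s : ℕ, 2 ≤ s →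
          KorobovPLR.cConst b s α γ (2 * α) ≤
            ctilde * (s : ℝ) ^ ((A + η) / ((b : ℝ) ^ (2 * α) - 1)) ∧
          ∀ m : ℕ, 1 ≤ m →
          ∀ p : Polynomial (ZMod b), Irreducible p → p.natDegree = m →
          ∀ q : Polynomial (ZMod b), KorobovPLR.IsKorobovMinimizer s p α γ q →
            KorobovPLR.B p (KorobovPLR.korobovVec s p q) α γ ≤
              ENNReal.ofReal (ctilde * (s : ℝ) ^ (1 + (A + η) / ((b : ℝ) ^ (2 * α) - 1)) *
                ((b : ℝ) ^ m - 1)⁻¹)) := by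
  refine ⟨?_, fun A hA η hη => ?_⟩
  · rintro b _ α hα - s hs m - p hp rfl q hq δ hδ0 hδ
    exact KorobovPLR.B_korobov_le hα (by omega) hp hγ_pos hq hδ0 hδ
  · obtain ⟨c, hc0, hc⟩ := KorobovPLR.exists_cConst_le hγ_pos hγ_anti hA hη
    refine ⟨c, hc0, fun b _ α hα _ s hs => ?_⟩
    have hb : 1 < b := (Fact.out : b.Prime).one_lt
    have hcb := hc b hb α hα s hs
    refine ⟨hcb, ?_⟩
    rintro m - p hp rfl q hq
    refine (KorobovPLR.B_korobov_le hα (by omega) hp hγ_pos hq (by positivity) le_rfl).trans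
      (ENNReal.ofReal_le_ofReal ?_)
    have hs0 : (0 : ℝ) < s := by exact_mod_cast (by omega : 0 < s)
    have hN : (1 : ℝ) ≤ (b : ℝ) ^ p.natDegree := one_le_pow₀ (by exact_mod_cast hb.le)
    rw [show 2 * α + 1 - 2 * α = 1 by ring, show -(2 * α + 1) + 2 * α = -1 by ring,
      Real.rpow_neg_one, Real.rpow_one, add_comm (1 : ℝ), Real.rpow_add hs0, Real.rpow_one,
      ← mul_assoc]
    have := inv_nonneg.2 (sub_nonneg.2 hN)
    gcongr
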